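/- **Setting.** Fix a buffer size $B$, $\mathcal Z=\{0,\dots,B\}$, a service rate $\alpha>0$, an epoch length $\Delta t>0$, a discount factor $\gamma\in[0,1)$, and a random process $(\lambda(t))_{t\in\mathbb N}$ of arrival rates per agent with values in $[0,\lambda_{\max}]$ (for instance a constant, or a Markov chain with finitely many values), which is independent of everything else. *Queue.* For an arrival rate $r\ge 0$ let $Q(r)$ be the $(B+1)\times(B+1)$ matrix with $Q_{i,i-1}=r$, $Q_{i-1,i}=\alpha$ ($1\le i\le B$), all other off-diagonal entries zero, and columns summing to zero. Let $\bar Q(r)$ be $Q(r)$ extended by a row $B+1$ and a zero column $B+1$, where the only nonzero entry of the new row is $\bar Q_{B+1,B}=r$. Then $\exp(\Delta t\,Q(r))e_z$ is the law of the queue filling at the end of an epoch started from the filling $z$, and $\mathrm{drop}(r,z)=[\exp(\Delta t\,\bar Q(r))e_z]_{B+1}$ is the expected number of packets dropped during this epoch. *System on a graph.* Let $G$ be a locally finite simple graph, let $N_i$ be the set of neighbours of the node (agent) $i$, and let $\mathbf z\in\mathcal Z^G$ be the initial queue fillings. A decision rule is a map $\zeta\colon\mathcal Z\to[0,1]$.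 Given a sequence $(\zeta_t)_{t\in\mathbb N}$ of decision rules, in each epoch $t$ all agents choose independently an action $a_i(t)\in\{0,1\}$, with $a_i(t)=1$ (offload to a uniformly random neighbour) with probability $\zeta_t(z_i(t))$ and $a_i(t)=0$ (send to the own queue) otherwise. The arrival rate at queue $i$ in epoch $t$ is $$r_i(t)=\lambda(t)\Bigl(1-a_i(t)+\sum_{j\in N_i}\frac{a_j(t)}{|N_j|}\Bigr),$$ the next fillings $z_i(t+1)$ are drawn independently from $\exp(\Delta t\,Q(r_i(t)))e_{z_i(t)}$, and $D_i(t)=\mathrm{drop}(r_i(t),z_i(t))$ is the expected number of packets dropped at queue $i$ in epoch $t$ given fillings, actions and arrival rate. *Local weak convergence.* Let $\mathcal G_*$ be the space of isomorphism classes of connected, locally finite rooted graphs $(G,\varnothing,\mathbf z)$ with marks in $\mathcal Z$. It carries the topology in which a sequence converges iff for every $k$ its members eventually have $k$-balls around the root isomorphic, as marked rooted graphs, to the $k$-ball of the limit. Random finite marked graphs $(G_n,\mathbf z_n)$ converge in probability in the local weak sense to a random element $(G,\mathbf z)$ of $\mathcal G_*$ if, for every bounded continuous $f\colon\mathcal G_*\to\mathbb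 R$, $$\frac1{|G_n|}\sum_{i\in G_n} f(C_i(G_n))\to\mathbb E[f(G)]\quad\text{in probability,}$$ where $C_i(G_n)$ is the connected component of $i$, with its marks, rooted at $i$. *Policies and objectives.* An upper-level MFC policy $\pi$ is an arbitrary (possibly time-dependent) map from laws on $\mathcal G_*$ to decision rules. Along the limiting system started in $(G,\mathbf z)$ it determines recursively the decision rules $\zeta_t=\pi_t(\mathcal L(G(t),\mathbf z(t)))$, where $\mathcal L(G(t),\mathbf z(t))$ is the law of the marked rooted graph at time $t$ after $\zeta_0,\dots,\zeta_{t-1}$ have been applied. With this sequence $(\zeta_t)_t$ used by all agents of the limiting system and of each finite system, put $$J^{G,\mathbf z}(\pi)=-\mathbb E\Bigl[\sum_{t=0}^\infty\gamma^tD_\varnothing(t)\Bigr],\qquad J^{G_n,\mathbf z_n}(\pi)=-\mathbb E\Bigl[\sum_{t=0}^\infty\gamma^t\,\frac1{|G_n|}\sum_{i\in G_n}D_i(t)\Bigr].$$ **Theorem 2.1.** Let $(G_n,\mathbf z_n)$ be random nonempty finite simple graphs with initial states in $\mathcal Z$, such that for some finite $d$, for every $n$, almost surely all nodes of $G_n$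 have at most $d$ neighbours. Suppose that $(G_n,\mathbf z_n)$ converges in probability in the local weak sense to a random marked rooted graph $(G,\mathbf z)$. Then for every upper-level MFC policy $\pi$, all of these objectives are finite and, as $n\to\infty$, $$J^{G_n,\mathbf z_n}(\pi)\to J^{G,\mathbf z}(\pi).$$ -/

import Mathlib

open MeasureTheory Filter Topology
open scoped ENNReal BoundedContinuousFunction

noncomputable section

/-! ### Marked rooted graphs and local weak convergence -/

/-- A connected, locally finite rooted graph with marks in `Z`.  This type holds the
representatives; its topology below does not separate isomorphic marked rooted graphs, so that
its Borel sets, Borel measures and continuous functions are those of the space of isomorphism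
classes. -/
structure MarkedRootedGraph (Z : Type) where
  /-- the nodes -/
  V : Type
  /-- the edges -/
  graph : SimpleGraph V
  connected : graph.Connected
  locallyFinite : ∀ v, (graph.neighborSet v).Finite
  /-- the root node -/
  root : V
  /-- the marks -/
  mark : V → Z

namespace MarkedRootedGraph

variable {Z : Type}

/-- The nodes at graph distance at most `k` from the root. -/
def ball (g : MarkedRootedGraph Z) (k : ℕ) : Set g.V := {v | g.graph.dist g.root v ≤ k}

/-- The marked rooted subgraphs induced on the `k`-balls of `g` and `h` are isomorphic. -/
def BallIso (k : ℕ) (g h : MarkedRootedGraph Z) : Prop :=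
  ∃ φ : g.graph.induce (g.ball k) ≃g h.graph.induce (h.ball k),
    (∀ v, v.1 = g.root ↔ (φ v).1 = h.root) ∧ ∀ v, h.mark (φ v).1 = g.mark v.1

/-- The topology of local convergence: the sets of graphs whose `k`-ball has a given isomorphism
type form a basis. -/
instance : TopologicalSpace (MarkedRootedGraph Z) :=
  TopologicalSpace.generateFrom {S | ∃ k g, S = {h | BallIso k g h}}

instance : MeasurableSpace (MarkedRootedGraph Z) := borel _

instance : BorelSpace (MarkedRootedGraph Z) := ⟨rfl⟩

end MarkedRootedGraph

/-- A nonempty finite graph (of any number `size` of nodes) with marks in `Z`. -/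
structure FiniteMarkedGraph (Z : Type) where
  /-- the number of nodes -/
  size : ℕ
  size_pos : 0 < size
  /-- the edges -/
  graph : SimpleGraph (Fin size)
  /-- the marks -/
  mark : Fin size → Z

namespace FiniteMarkedGraph

variable {Z : Type}

/-- Used for countable `Z`, where there are countably many finite marked graphs. -/
instance : MeasurableSpace (FiniteMarkedGraph Z) := ⊤

/-- The connected component of the node `i`, with its marks, rooted at `i`. -/
def component (g : FiniteMarkedGraph Z) (i : Fin g.size) : MarkedRootedGraph Z where
  V := g.graph.connectedComponentMk i
  graph := (g.graph.connectedComponentMk i).toSimpleGraph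
  connected := (g.graph.connectedComponentMk i).connected_toSimpleGraph
  locallyFinite _ := Set.toFinite _
  root := ⟨i, rfl⟩
  mark v := g.mark v

end FiniteMarkedGraph

/-- Convergence in probability in the local weak sense of the random finite marked graphs `X n`
to a random marked rooted graph with law `L`. -/
def LocalWeakConvergesInProbability {Z : Type} {Ω : Type*} [MeasurableSpace Ω] (P : Measure Ω)
    (X : ℕ → Ω → FiniteMarkedGraph Z) (L : Measure (MarkedRootedGraph Z)) : Prop :=
  ∀ f : MarkedRootedGraph Z →ᵇ ℝ,
    TendstoInMeasure P
      (fun n ω => (∑ i, f ((X n ω).component i)) / ((X n ω).size : ℝ)) atTop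
      (fun _ => ∫ g, f g ∂L)

/-! ### One queue during one epoch -/

/-- Numerical parameters: service rate, length of an epoch, discount factor. -/
structure QueueParams where
  /-- service rate -/
  α : ℝ
  α_pos : 0 < α
  /-- synchronization delay, i.e. the length of an epoch -/
  Δt : ℝ
  Δt_pos : 0 < Δt
  /-- discount factor -/
  γ : ℝ
  γ_nonneg : 0 ≤ γ
  γ_lt_one : γ < 1

/-- Jump rates of a queue with buffer size `B` and arrival rate `r`; the entry `(i, j)` is the
rate of the jump from `j` to `i`. -/
def jumpRate (p : QueueParams) (B : ℕ) (r : ℝ) : Matrix (Fin (B + 1)) (Fin (B + 1)) ℝ :=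
  Matrix.of fun i j =>
    if (i : ℕ) = j + 1 then r else if (j : ℕ) = i + 1 then p.α else 0

/-- The generator `Q` of the queue (columns sum to zero). -/
def generator (p : QueueParams) (B : ℕ) (r : ℝ) : Matrix (Fin (B + 1)) (Fin (B + 1)) ℝ :=
  jumpRate p B r - Matrix.diagonal fun j => ∑ k, jumpRate p B r k j

/-- Law of the queue filling at the end of an epoch, started from filling `x`. -/
def transitionProb (p : QueueParams) {B : ℕ} (r : ℝ) (x : Fin (B + 1)) : Fin (B + 1) → ℝ :=
  fun y => NormedSpace.exp (p.Δt • generator p B r) y x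

/-- The generator with an additional row that counts the arrivals at a full queue. -/
def extendedGenerator (p : QueueParams) (B : ℕ) (r : ℝ) :
    Matrix (Fin (B + 1) ⊕ Unit) (Fin (B + 1) ⊕ Unit) ℝ :=
  Matrix.fromBlocks (generator p B r) 0
    (Matrix.of fun _ j => if j = Fin.last B then r else 0) 0

/-- Expected number of packets that a queue with arrival rate `r`, started from filling `x`,
drops during an epoch. -/
def expectedDrops (p : QueueParams) {B : ℕ} (r : ℝ) (x : Fin (B + 1)) : ℝ :=
  NormedSpace.exp (p.Δt • extendedGenerator p B r) (Sum.inr ()) (Sum.inl x)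

open Classical in
/-- Inverse transform sampling: if `u` is uniform on `[0, 1]`, then `sample q u` has law `q`, for
every probability vector `q`. The value is the number of `k < B` with `q 0 + ... + q k < u`. -/
def sample {B : ℕ} (q : Fin (B + 1) → ℝ) (u : unitInterval) : Fin (B + 1) :=
  ⟨(Finset.univ.filter fun k : Fin B =>
      ∑ j ∈ Finset.univ.filter (fun j : Fin (B + 1) => (j : ℕ) ≤ k), q j < (u : ℝ)).card,
    Nat.lt_succ_of_le ((Finset.card_le_univ _).trans_eq (Fintype.card_fin B))⟩

/-! ### The queueing system on a graph -/

/-- A decentralized control policy at one time: the probability with which an agent offloads to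
a random neighbour, given the filling of its own queue. -/
abbrev DecisionRule (B : ℕ) : Type := Fin (B + 1) → unitInterval

/-- The randomness of the agents: for every epoch and every agent two independent uniform
variables, `false` for the action and `true` for the next queue filling. -/
abbrev Noise (V : Type) : Type := ℕ × V × Bool → unitInterval

/-- The law of the noise. -/
def noiseMeasure (V : Type) : Measure (Noise V) := Measure.infinitePi fun _ => volume

/-- The arrival rate at the queue of agent `i` when the arrival rate per agent is `lam` and the
agents act by `a` (`true` is offloading, `false` is sending to the own queue). -/
def arrivalRate {V : Type} (G : SimpleGraph V) (lam : ℝ) (a : V → Bool) (i : V) : ℝ :=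
  lam * (1 - ((a i).toNat : ℝ) +
    ∑ᶠ j ∈ G.neighborSet i, ((a j).toNat : ℝ) / ((G.neighborSet j).ncard : ℝ))

open Classical in
/-- The actions in epoch `t` if the agents have queue fillings `z`: independently, agent `i`
offloads with probability `ζ (z i)`. -/
def actions {V : Type} {B : ℕ} (ζ : DecisionRule B) (ω : Noise V) (t : ℕ)
    (z : V → Fin (B + 1)) : V → Bool :=
  fun i => decide (ω (t, i, false) ≤ ζ (z i))

/-- The queue fillings at time `t`, with initial fillings `z₀`, control policies `ζ s` and arrival
rates `lam s` at the times `s`. -/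
def queueState {V : Type} {B : ℕ} (p : QueueParams) (G : SimpleGraph V)
    (ζ : ℕ → DecisionRule B) (lam : ℕ → ℝ) (z₀ : V → Fin (B + 1)) (ω : Noise V) :
    ℕ → V → Fin (B + 1)
  | 0 => z₀
  | t + 1 => fun i =>
      let z := queueState p G ζ lam z₀ ω t
      sample (transitionProb p (arrivalRate G (lam t) (actions (ζ t) ω t z) i) (z i))
        (ω (t, i, true))

/-- The expected number of packets dropped at the queue of agent `i` in epoch `t`, given the queue
fillings, the actions and the arrival rate of that epoch. -/
def packetDrops {V : Type} {B : ℕ} (p : QueueParams) (G : SimpleGraph V)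
    (ζ : ℕ → DecisionRule B) (lam : ℕ → ℝ) (z₀ : V → Fin (B + 1)) (ω : Noise V)
    (t : ℕ) (i : V) : ℝ :=
  let z := queueState p G ζ lam z₀ ω t
  expectedDrops p (arrivalRate G (lam t) (actions (ζ t) ω t z) i) (z i)

/-! ### The limiting system and upper-level policies -/

/-- The marked rooted graph at time `t`: the same rooted graph, marked by the queue fillings. -/
def MarkedRootedGraph.evolve {B : ℕ} (p : QueueParams) (ζ : ℕ → DecisionRule B) (lam : ℕ → ℝ)
    (g : MarkedRootedGraph (Fin (B + 1))) (ω : Noise g.V) (t : ℕ) :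
    MarkedRootedGraph (Fin (B + 1)) where
  V := g.V
  graph := g.graph
  connected := g.connected
  locallyFinite := g.locallyFinite
  root := g.root
  mark := queueState p g.graph ζ lam g.mark ω t

/-- The law of the marked rooted graph at time `t`, if it has law `L` at time `0` and if the
arrival rates form a random process `Λ` that is independent of everything else. -/
def systemLaw {B : ℕ} {Ω₀ : Type*} [MeasurableSpace Ω₀] (p : QueueParams) (ℙ : Measure Ω₀)
    (Λ : ℕ → Ω₀ → ℝ) (L : Measure (MarkedRootedGraph (Fin (B + 1))))
    (ζ : ℕ → DecisionRule B) (t : ℕ) : Measure (MarkedRootedGraph (Fin (B + 1))) :=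
  L.bind fun g => (ℙ.prod (noiseMeasure g.V)).map fun x =>
    g.evolve p ζ (fun s => Λ s x.1) x.2 t

/-- A (possibly time-dependent) upper-level policy assigns a decision rule to each law of the
limiting system. -/
abbrev UpperPolicy (B : ℕ) : Type 1 :=
  ℕ → Measure (MarkedRootedGraph (Fin (B + 1))) → DecisionRule B

/-- The control policies `ζ t` that the upper-level policy `π` chooses along the limiting system:
`ζ t` is the value of `π t` at the law at time `t` under `ζ 0, ..., ζ (t - 1)`. (The law at time
`t` does not depend on the values used here for later times.) -/
def mfcControl {B : ℕ} {Ω₀ : Type*} [MeasurableSpace Ω₀] (p : QueueParams) (ℙ : Measure Ω₀)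
    (Λ : ℕ → Ω₀ → ℝ) (L : Measure (MarkedRootedGraph (Fin (B + 1)))) (π : UpperPolicy B)
    (t : ℕ) : DecisionRule B :=
  π t (systemLaw p ℙ Λ L (fun s => if _h : s < t then mfcControl p ℙ Λ L π s else fun _ => 0) t)
termination_by t

/-! ### Objectives -/

/-- Expected discounted number of packets dropped at the root of the limiting system. -/
def limitCost {B : ℕ} {Ω₀ : Type*} [MeasurableSpace Ω₀] (p : QueueParams) (ℙ : Measure Ω₀)
    (Λ : ℕ → Ω₀ → ℝ) (L : Measure (MarkedRootedGraph (Fin (B + 1))))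
    (ζ : ℕ → DecisionRule B) : ℝ≥0∞ :=
  ∫⁻ g, ∫⁻ x, ∑' t : ℕ, ENNReal.ofReal
      (p.γ ^ t * packetDrops p g.graph ζ (fun s => Λ s x.1) g.mark x.2 t g.root)
    ∂(ℙ.prod (noiseMeasure g.V)) ∂L

/-- Expected discounted number of packets dropped per agent of the finite system on the random
marked graph `X`. -/
def finiteCost {B : ℕ} {Ω₀ Ω : Type*} [MeasurableSpace Ω₀] [MeasurableSpace Ω] (p : QueueParams)
    (ℙ : Measure Ω₀) (Λ : ℕ → Ω₀ → ℝ) (P : Measure Ω)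
    (X : Ω → FiniteMarkedGraph (Fin (B + 1))) (ζ : ℕ → DecisionRule B) : ℝ≥0∞ :=
  ∫⁻ ω, ∫⁻ x, ∑' t : ℕ, ENNReal.ofReal
      (p.γ ^ t * ((∑ i, packetDrops p (X ω).graph ζ (fun s => Λ s x.1) (X ω).mark x.2 t i) /
        ((X ω).size : ℝ)))
    ∂(ℙ.prod (noiseMeasure (Fin (X ω).size))) ∂P

/-- The objective in the limiting system. -/
def limitObjective {B : ℕ} {Ω₀ : Type*} [MeasurableSpace Ω₀] (p : QueueParams) (ℙ : Measure Ω₀)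
    (Λ : ℕ → Ω₀ → ℝ) (L : Measure (MarkedRootedGraph (Fin (B + 1))))
    (π : UpperPolicy B) : ℝ :=
  -(limitCost p ℙ Λ L (mfcControl p ℙ Λ L π)).toReal

/-- The objective in the finite system, where all agents use the control policies that the
upper-level policy `π` chooses along the limiting system with initial law `L`. -/
def finiteObjective {B : ℕ} {Ω₀ Ω : Type*} [MeasurableSpace Ω₀] [MeasurableSpace Ω]
    (p : QueueParams) (ℙ : Measure Ω₀) (Λ : ℕ → Ω₀ → ℝ)
    (L : Measure (MarkedRootedGraph (Fin (B + 1)))) (P : Measure Ω)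
    (X : Ω → FiniteMarkedGraph (Fin (B + 1))) (π : UpperPolicy B) : ℝ :=
  -(finiteCost p ℙ Λ P X (mfcControl p ℙ Λ L π)).toReal

end

/-! The sequence `ζ` of decision rules is computed along the limiting system alone, so it is
deterministic and common to all systems; it suffices to treat a fixed `ζ`. Integrate out arrival
rates and noise with the graph held fixed. What remains at epoch `t` is a function of the marked
graph seen from a node, and this function is local: information travels one edge per epoch, and an
arrival rate involves the actions and degrees of the neighbours, so the drops at the root depend
only on its `(t + 2)`-ball (`discountedDrops_root_eq_of_ballIso`). Hence each term is locally
constant on the space of marked rooted graphs.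

If the root has degree at most `d`, its arrival rate is at most `lamMax * (1 + d)`, and the term is
at most `γ ^ t * M`. Setting the terms to zero at roots of larger degree keeps them locally
constant, and the Weierstrass test makes their sum `truncatedCost` a bounded continuous function `F`
(`continuous_truncatedCost`). The finite cost is the expectation of the average of `F` over the
rooted components (`lintegral_tsum_average_drops`). The limit cost is `∫ F ∂L`, because the degree
bound passes to the root of the limit (`ae_degree_root_le`). Local weak convergence tested on `F`,
followed by bounded convergence, gives the claim. -/

noncomputable section

/-! ### Exponentials of matrices with nonnegative off-diagonal entries -/

section MatrixExp

variable {n : Type*} [Fintype n] [DecidableEq n]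

attribute [local instance] Matrix.linftyOpNormedRing Matrix.linftyOpNormedAlgebra in
theorem Matrix.continuous_exp : Continuous fun A : Matrix n n ℝ => NormedSpace.exp A :=
  NormedSpace.exp_continuous

attribute [local instance] Matrix.linftyOpNormedRing Matrix.linftyOpNormedAlgebra in
theorem Matrix.hasSum_exp_apply (A : Matrix n n ℝ) (i j : n) :
    HasSum (fun k : ℕ => ((k.factorial : ℝ)⁻¹ • A ^ k) i j) (NormedSpace.exp A i j) := by
  have h : HasSum (fun k : ℕ => (k.factorial : ℝ)⁻¹ • A ^ k) (NormedSpace.exp A) :=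
    NormedSpace.exp_series_hasSum_exp' A
  have h' := Pi.hasSum.1 h i
  exact Pi.hasSum.1 h' j

theorem Matrix.exp_nonneg_of_nonneg {A : Matrix n n ℝ} (hA : ∀ i j, 0 ≤ A i j) (i j : n) :
    0 ≤ NormedSpace.exp A i j := by
  have hpow : ∀ k : ℕ, ∀ i j, 0 ≤ (A ^ k) i j := by
    intro k
    induction k with
    | zero =>
      intro i j
      rw [pow_zero, Matrix.one_apply]
      split_ifs <;> norm_num
    | succ k ih =>
      intro i j
      rw [pow_succ, Matrix.mul_apply]
      exact Finset.sum_nonneg fun l _ => mul_nonneg (ih i l) (hA l j)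
  refine (Matrix.hasSum_exp_apply A i j).nonneg fun k => ?_
  rw [Matrix.smul_apply, smul_eq_mul]
  exact mul_nonneg (by positivity) (hpow k i j)

/-- Adding a large multiple `c` of the identity makes all entries nonnegative, and costs only the
positive factor `exp (-c)`. Applied to the extended generator, this shows that expected drops are
nonnegative, so `ENNReal.ofReal` does not truncate them in the costs. -/
theorem Matrix.exp_nonneg_of_offDiag_nonneg {A : Matrix n n ℝ}
    (hA : ∀ i j, i ≠ j → 0 ≤ A i j) (i j : n) : 0 ≤ NormedSpace.exp A i j := by
  set c : ℝ := ∑ k, |A k k| with hc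
  have hsplit : A = (A + Matrix.diagonal fun _ => c) + Matrix.diagonal fun _ => -c := by
    rw [add_assoc, Matrix.diagonal_add]
    simp
  have hcomm : Commute (A + Matrix.diagonal fun _ => c) (Matrix.diagonal fun _ : n => -c) :=
    (Matrix.scalar_commute (n := n) (-c) (fun r => mul_comm _ r) _).symm
  rw [hsplit, Matrix.exp_add_of_commute _ _ hcomm, Matrix.exp_diagonal, Matrix.mul_diagonal]
  refine mul_nonneg (Matrix.exp_nonneg_of_nonneg (fun k l => ?_) i j) ?_
  · by_cases h : k = l
    · subst h
      have : |A k k| ≤ c :=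
        Finset.single_le_sum (f := fun k => |A k k|) (fun _ _ => abs_nonneg _) (Finset.mem_univ k)
      have h2 := neg_abs_le (A k k)
      simp only [Matrix.add_apply, Matrix.diagonal_apply_eq]
      linarith
    · simpa [Matrix.diagonal_apply_ne _ h] using hA k l h
  · rw [Pi.coe_exp, ← Real.exp_eq_exp_ℝ]
    exact (Real.exp_pos _).le

end MatrixExp

/-! ### Expected drops and transition probabilities of one queue -/

section Queue

variable (p : QueueParams) {B : ℕ}

theorem jumpRate_nonneg {r : ℝ} (hr : 0 ≤ r) (i j : Fin (B + 1)) : 0 ≤ jumpRate p B r i j := by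
  unfold jumpRate
  rw [Matrix.of_apply]
  split_ifs
  exacts [hr, p.α_pos.le, le_rfl]

theorem expectedDrops_nonneg {r : ℝ} (hr : 0 ≤ r) (x : Fin (B + 1)) :
    0 ≤ expectedDrops p r x := by
  refine Matrix.exp_nonneg_of_offDiag_nonneg (fun i j hij => ?_) _ _
  rw [Matrix.smul_apply, smul_eq_mul]
  refine mul_nonneg p.Δt_pos.le ?_
  unfold extendedGenerator
  rcases i with i | i <;> rcases j with j | j
  · have hne : i ≠ j := fun h => hij (congrArg _ h)
    rw [Matrix.fromBlocks_apply₁₁, generator, Matrix.sub_apply, Matrix.diagonal_apply_ne _ hne,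
      sub_zero]
    exact jumpRate_nonneg p hr i j
  · simp
  · rw [Matrix.fromBlocks_apply₂₁, Matrix.of_apply]
    split_ifs
    exacts [hr, le_rfl]
  · simp

theorem continuous_jumpRate (i j : Fin (B + 1)) : Continuous fun r => jumpRate p B r i j := by
  unfold jumpRate
  simp only [Matrix.of_apply]
  split_ifs <;> fun_prop

theorem continuous_generator : Continuous fun r => generator p B r := by
  refine continuous_matrix fun i j => ?_
  simp only [generator, Matrix.sub_apply, Matrix.diagonal_apply]
  refine (continuous_jumpRate p i j).sub ?_
  split_ifs
  · exact continuous_finsetSum _ fun k _ => continuous_jumpRate p k i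
  · exact continuous_const

theorem continuous_transitionProb (x y : Fin (B + 1)) :
    Continuous fun r => transitionProb p r x y :=
  (Matrix.continuous_exp.comp ((continuous_generator p).const_smul p.Δt)).matrix_elem y x

theorem continuous_expectedDrops (x : Fin (B + 1)) :
    Continuous fun r => expectedDrops p r x := by
  have h : Continuous fun r => extendedGenerator p B r := by
    refine (continuous_generator p).matrix_fromBlocks continuous_const
      (continuous_matrix fun i j => ?_) continuous_const
    simp only [Matrix.of_apply]
    split_ifs <;> fun_prop
  exact (Matrix.continuous_exp.comp (h.const_smul p.Δt)).matrix_elem (Sum.inr ()) (Sum.inl x)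

/-- Compactness of `[0, R]` suffices; the value of `M` plays no role. Summing absolute values over
the fillings gives one bound for all of them, nonnegative even if the interval is empty. -/
theorem exists_expectedDrops_le (B : ℕ) (R : ℝ) :
    ∃ M : ℝ, 0 ≤ M ∧ ∀ r ∈ Set.Icc 0 R, ∀ x : Fin (B + 1), expectedDrops p r x ≤ M := by
  have h : ∀ x : Fin (B + 1), ∃ M : ℝ, ∀ r ∈ Set.Icc 0 R, expectedDrops p r x ≤ M := fun x => by
    obtain ⟨M, hM⟩ := (isCompact_Icc (a := (0 : ℝ)) (b := R)).bddAbove_image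
      (continuous_expectedDrops p x).continuousOn
    exact ⟨M, fun r hr => hM (Set.mem_image_of_mem _ hr)⟩
  choose M hM using h
  refine ⟨∑ x, |M x|, Finset.sum_nonneg fun _ _ => abs_nonneg _, fun r hr x => ?_⟩
  exact ((hM x r hr).trans (le_abs_self _)).trans
    (Finset.single_le_sum (f := fun x => |M x|) (fun _ _ => abs_nonneg _) (Finset.mem_univ x))

theorem measurable_sample :
    Measurable fun x : (Fin (B + 1) → ℝ) × unitInterval => sample x.1 x.2 := by
  classical
  refine measurable_to_countable' fun y => ?_
  have hsum : Measurable fun x : (Fin (B + 1) → ℝ) × unitInterval =>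
      ∑ k : Fin B, if ∑ j ∈ Finset.univ.filter (fun j : Fin (B + 1) => (j : ℕ) ≤ k), x.1 j <
        (x.2 : ℝ) then 1 else 0 := by
    refine Finset.measurable_sum _ fun k _ => Measurable.ite ?_ measurable_const measurable_const
    refine measurableSet_lt (Finset.measurable_sum _ fun j _ => ?_)
      (measurable_subtype_coe.comp measurable_snd)
    exact (measurable_pi_apply j).comp measurable_fst
  convert hsum (measurableSet_singleton (y : ℕ)) using 1
  ext x
  simp only [Set.mem_preimage, Set.mem_singleton_iff, Fin.ext_iff, sample,
    Finset.card_filter]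

theorem measurable_transitionProb_uncurry (k : Fin (B + 1)) :
    Measurable fun v : ℝ × Fin (B + 1) => transitionProb p v.1 v.2 k :=
  measurable_from_prod_countable_left fun x => (continuous_transitionProb p x k).measurable

theorem measurable_expectedDrops_uncurry :
    Measurable fun v : ℝ × Fin (B + 1) => expectedDrops p v.1 v.2 :=
  measurable_from_prod_countable_left fun x => (continuous_expectedDrops p x).measurable

theorem measurable_sample_transitionProb {Y : Type*} [MeasurableSpace Y] {r : Y → ℝ}
    {x : Y → Fin (B + 1)} {u : Y → unitInterval} (hr : Measurable r) (hx : Measurable x)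
    (hu : Measurable u) : Measurable fun y => sample (transitionProb p (r y) (x y)) (u y) := by
  have hq : Measurable fun y => transitionProb p (r y) (x y) :=
    measurable_pi_lambda _ fun k => by
      have h := (measurable_transitionProb_uncurry p k).comp (hr.prodMk hx)
      simpa only [Function.comp_def] using h
  have h := measurable_sample.comp (hq.prodMk hu)
  simpa only [Function.comp_def] using h

theorem measurable_expectedDrops {Y : Type*} [MeasurableSpace Y] {r : Y → ℝ}
    {x : Y → Fin (B + 1)} (hr : Measurable r) (hx : Measurable x) :
    Measurable fun y => expectedDrops p (r y) (x y) := by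
  have h := (measurable_expectedDrops_uncurry p).comp (hr.prodMk hx)
  simpa only [Function.comp_def] using h

end Queue

/-! ### Rates, measurability -/

section System

variable (p : QueueParams) {V : Type} {B : ℕ}

theorem offload_nonneg (G : SimpleGraph V) (a : V → Bool) (j : V) :
    0 ≤ ((a j).toNat : ℝ) / ((G.neighborSet j).ncard : ℝ) := by positivity

theorem arrivalRate_nonneg (G : SimpleGraph V) {lam : ℝ} (hlam : 0 ≤ lam) (a : V → Bool)
    (i : V) : 0 ≤ arrivalRate G lam a i := by
  refine mul_nonneg hlam (add_nonneg ?_ ?_)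
  · cases a i <;> simp
  · exact finsum_nonneg fun j => finsum_nonneg fun _ => offload_nonneg G a j

theorem arrivalRate_eq_sum {G : SimpleGraph V} {i : V} (hi : (G.neighborSet i).Finite) (lam : ℝ)
    (a : V → Bool) : arrivalRate G lam a i = lam * (1 - ((a i).toNat : ℝ) +
      ∑ j ∈ hi.toFinset, ((a j).toNat : ℝ) / ((G.neighborSet j).ncard : ℝ)) := by
  unfold arrivalRate
  rw [finsum_mem_eq_finite_toFinset_sum _ hi]

theorem arrivalRate_le {G : SimpleGraph V} {i : V} (hi : (G.neighborSet i).Finite) {d : ℕ}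
    (hd : (G.neighborSet i).ncard ≤ d) {lam lamMax : ℝ} (hlam : 0 ≤ lam) (hmax : lam ≤ lamMax)
    (a : V → Bool) : arrivalRate G lam a i ≤ lamMax * (1 + d) := by
  rw [arrivalRate_eq_sum hi]
  refine mul_le_mul hmax (add_le_add ?_ ?_) ?_ (hlam.trans hmax)
  · cases a i <;> simp
  · calc ∑ j ∈ hi.toFinset, ((a j).toNat : ℝ) / ((G.neighborSet j).ncard : ℝ)
        ≤ ∑ j ∈ hi.toFinset, (1 : ℝ) := by
          refine Finset.sum_le_sum fun j _ => ?_
          have h1 : ((a j).toNat : ℝ) ≤ 1 := by cases a j <;> simp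
          -- The value `0` occurs when `j` has infinitely many neighbours; the quotient is then `0`
          -- by convention.
          rcases Nat.eq_zero_or_pos (G.neighborSet j).ncard with h | h
          · simp [h]
          · have h2 : (1 : ℝ) ≤ ((G.neighborSet j).ncard : ℝ) := by exact_mod_cast h
            exact div_le_one_of_le₀ (h1.trans h2) (by positivity)
      _ = ((G.neighborSet i).ncard : ℝ) := by
          rw [Finset.sum_const, nsmul_eq_mul, mul_one, Set.ncard_eq_toFinset_card _ hi]
      _ ≤ d := by exact_mod_cast hd
  · refine add_nonneg ?_ (Finset.sum_nonneg fun j _ => offload_nonneg G a j)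
    cases a i <;> simp

theorem packetDrops_nonneg (G : SimpleGraph V) (ζ : ℕ → DecisionRule B) {lam : ℕ → ℝ}
    (hlam : ∀ s, 0 ≤ lam s) (z₀ : V → Fin (B + 1)) (ω : Noise V) (t : ℕ) (i : V) :
    0 ≤ packetDrops p G ζ lam z₀ ω t i :=
  expectedDrops_nonneg p (arrivalRate_nonneg G (hlam t) _ i) _

variable {G : SimpleGraph V}

theorem measurable_arrivalRate_actions (hG : ∀ v, (G.neighborSet v).Finite)
    (ζ : DecisionRule B) (t : ℕ)
    {Y : Type*} [MeasurableSpace Y] {lam : Y → ℝ} (hlam : Measurable lam) {η : Y → Noise V}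
    (hη : Measurable η) {z : Y → V → Fin (B + 1)} (hz : ∀ i, Measurable fun y => z y i) (i : V) :
    Measurable fun y => arrivalRate G (lam y) (actions ζ (η y) t (z y)) i := by
  have hact : ∀ j, Measurable fun y => ((actions ζ (η y) t (z y) j).toNat : ℝ) := fun j => by
    have hS : MeasurableSet {y | η y (t, j, false) ≤ ζ (z y j)} :=
      measurableSet_le ((measurable_pi_apply _).comp hη)
        ((measurable_of_countable ζ).comp (hz j))
    classical
    have h2 : (fun y => ((actions ζ (η y) t (z y) j).toNat : ℝ)) =
        fun y => if y ∈ {y | η y (t, j, false) ≤ ζ (z y j)} then (1 : ℝ) else 0 := by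
      ext y
      by_cases h : η y (t, j, false) ≤ ζ (z y j) <;> simp [actions, h]
    rw [h2]
    exact Measurable.ite hS measurable_const measurable_const
  simp only [arrivalRate_eq_sum (hG i)]
  exact hlam.mul ((measurable_const.sub (hact i)).add
    (Finset.measurable_sum _ fun j _ => (hact j).div_const _))

theorem measurable_queueState (hG : ∀ v, (G.neighborSet v).Finite)
    (ζ : ℕ → DecisionRule B) (z₀ : V → Fin (B + 1)) {Y : Type*}
    [MeasurableSpace Y] {lam : Y → ℕ → ℝ} (hlam : ∀ s, Measurable fun y => lam y s)
    {η : Y → Noise V} (hη : Measurable η) (t : ℕ) :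
    ∀ i, Measurable fun y => queueState p G ζ (lam y) z₀ (η y) t i := by
  induction t with
  | zero => exact fun _ => measurable_const
  | succ t ih =>
    intro i
    have hr := measurable_arrivalRate_actions hG (ζ t) t (hlam t) hη ih i
    have hu : Measurable fun y => η y (t, i, true) := (measurable_pi_apply (t, i, true)).comp hη
    simp only [queueState]
    exact measurable_sample_transitionProb p hr (ih i) hu

theorem measurable_packetDrops (hG : ∀ v, (G.neighborSet v).Finite)
    (ζ : ℕ → DecisionRule B) (z₀ : V → Fin (B + 1)) {Y : Type*}
    [MeasurableSpace Y] {lam : Y → ℕ → ℝ} (hlam : ∀ s, Measurable fun y => lam y s)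
    {η : Y → Noise V} (hη : Measurable η) (t : ℕ) (i : V) :
    Measurable fun y => packetDrops p G ζ (lam y) z₀ (η y) t i := by
  have hz := measurable_queueState p hG ζ z₀ hlam hη t
  exact measurable_expectedDrops p (measurable_arrivalRate_actions hG (ζ t) t (hlam t) hη hz i) (hz i)

end System

/-! ### Relabelling of the noise -/

section Relabel

variable {V W : Type}

/-- The noise on `V` obtained from the noise on `W` by a map of the nodes. -/
def Noise.comap (f : V → W) (ω : Noise W) : Noise V := fun x => ω (x.1, f x.2.1, x.2.2)

theorem Noise.measurable_comap (f : V → W) : Measurable (Noise.comap f) :=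
  measurable_pi_lambda _ fun _ => measurable_pi_apply _

instance (V : Type) : IsProbabilityMeasure (noiseMeasure V) := by
  unfold noiseMeasure; infer_instance

/-- An injection selects distinct coordinates, which are again independent and uniform. On boxes:
the preimage is a box over the image indices, with sides transported by `Function.extend`. -/
theorem noiseMeasure_map_comap {f : V → W} (hf : Function.Injective f) :
    (noiseMeasure W).map (Noise.comap f) = noiseMeasure V := by
  classical
  refine Measure.eq_infinitePi _ fun s t ht => ?_
  have hF : Function.Injective fun x : ℕ × V × Bool => (x.1, f x.2.1, x.2.2) := by
    rintro ⟨a, b, c⟩ ⟨a', b', c'⟩ h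
    simp only [Prod.mk.injEq] at h
    simp [h.1, hf h.2.1, h.2.2]
  rw [Measure.map_apply (Noise.measurable_comap f)
    (MeasurableSet.pi s.countable_toSet fun i _ => ht i)]
  let t' : ℕ × W × Bool → Set unitInterval :=
    Function.extend (fun x : ℕ × V × Bool => (x.1, f x.2.1, x.2.2)) t fun _ => Set.univ
  have ht' : ∀ x, t' (x.1, f x.2.1, x.2.2) = t x := fun x => hF.extend_apply t _ x
  have hpre : Noise.comap f ⁻¹' Set.pi s t =
      Set.pi (s.image fun x : ℕ × V × Bool => (x.1, f x.2.1, x.2.2)) t' := by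
    ext ω
    simp only [Set.mem_preimage, Set.mem_pi, Finset.mem_coe, Finset.forall_mem_image, ht',
      Noise.comap]
  rw [hpre, noiseMeasure, Measure.infinitePi_pi, Finset.prod_image hF.injOn]
  · simp only [ht']
  · intro x hx
    obtain ⟨y, -, rfl⟩ := Finset.mem_image.1 hx
    rw [ht']
    exact ht y

end Relabel

/-! ### Locality of the dynamics -/

section Locality

variable {V W : Type}

/-- The map `f` of nodes sends the neighbours of `v` onto the neighbours of `f v`. -/
def PreservesNeighbors (G : SimpleGraph V) (H : SimpleGraph W) (f : V → W) (v : V) : Prop :=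
  f '' G.neighborSet v = H.neighborSet (f v)

variable {G : SimpleGraph V} {H : SimpleGraph W} {f : V → W}

theorem PreservesNeighbors.ncard_eq (hf : Function.Injective f) {v : V}
    (h : PreservesNeighbors G H f v) :
    (H.neighborSet (f v)).ncard = (G.neighborSet v).ncard := by
  rw [← h, Set.ncard_image_of_injective _ hf]

/-- Neighbours must preserve their own neighbourhoods too, because their degrees occur as
denominators. This is why the radius grows by one beyond the reach of the actions. -/
theorem arrivalRate_eq_of_preservesNeighbors (hf : Function.Injective f) {v : V}
    (hv : PreservesNeighbors G H f v) (hn : ∀ u, G.Adj v u → PreservesNeighbors G H f u)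
    {a : V → Bool} {b : W → Bool} (hab : b (f v) = a v) (habn : ∀ u, G.Adj v u → b (f u) = a u)
    (lam : ℝ) : arrivalRate H lam b (f v) = arrivalRate G lam a v := by
  unfold arrivalRate
  rw [← hv, finsum_mem_image hf.injOn, hab]
  congr 2
  refine finsum_mem_congr rfl fun u hu => ?_
  rw [habn u hu, (hn u hu).ncard_eq hf]

variable {B : ℕ} (p : QueueParams)

theorem actions_eq_of_comap {ζ : DecisionRule B} {ω : Noise W} {t : ℕ} {z : V → Fin (B + 1)}
    {z' : W → Fin (B + 1)} {v : V} (h : z' (f v) = z v) :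
    actions ζ ω t z' (f v) = actions ζ (Noise.comap f ω) t z v := by
  simp only [actions, h]
  rfl

variable {r : V → ℕ} {T : ℕ} {z : V → Fin (B + 1)} {z' : W → Fin (B + 1)}
  (ζ : ℕ → DecisionRule B) (lam : ℕ → ℝ) (ω : Noise W)

/-- The function `r` abstracts the distance to the root: it rises by at most one along an edge, and
each epoch uses up one unit of the budget `T + 1`. The same statement thus serves balls (`r` the
distance) and whole components (`r = 0`). -/
theorem queueState_eq_of_comap (hf : Function.Injective f)
    (hr : ∀ u v, G.Adj u v → r v ≤ r u + 1)
    (hgood : ∀ v, r v ≤ T + 1 → PreservesNeighbors G H f v) (hz : ∀ v, z' (f v) = z v) (t : ℕ) :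
    ∀ v, r v + t ≤ T + 1 → queueState p H ζ lam z' ω t (f v) =
      queueState p G ζ lam z (Noise.comap f ω) t v := by
  induction t with
  | zero => exact fun v _ => hz v
  | succ t ih =>
    intro v hv
    have hzv := ih v (by omega)
    have hrate := arrivalRate_eq_of_preservesNeighbors hf (hgood v (by omega))
      (fun u hu => hgood u (by have := hr v u hu; omega))
      (actions_eq_of_comap (ζ := ζ t) (ω := ω) (t := t) hzv)
      (fun u hu => actions_eq_of_comap (ih u (by have := hr v u hu; omega))) (lam t)
    simp only [queueState]
    rw [hrate, hzv]
    rfl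

theorem packetDrops_eq_of_comap (hf : Function.Injective f)
    (hr : ∀ u v, G.Adj u v → r v ≤ r u + 1)
    (hgood : ∀ v, r v ≤ T + 1 → PreservesNeighbors G H f v) (hz : ∀ v, z' (f v) = z v) {t : ℕ}
    {v : V} (hv : r v + t ≤ T) : packetDrops p H ζ lam z' ω t (f v) =
      packetDrops p G ζ lam z (Noise.comap f ω) t v := by
  have hst := queueState_eq_of_comap p ζ lam ω hf hr hgood hz t
  have hzv := hst v (by omega)
  have hrate := arrivalRate_eq_of_preservesNeighbors hf (hgood v (by omega))
    (fun u hu => hgood u (by have := hr v u hu; omega))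
    (actions_eq_of_comap (ζ := ζ t) (ω := ω) (t := t) hzv)
    (fun u hu => actions_eq_of_comap (hst u (by have := hr v u hu; omega))) (lam t)
  simp only [packetDrops]
  rw [hrate, hzv]

end Locality

/-! ### Discounted expected drops at one node -/

section Drops

variable (p : QueueParams) {B : ℕ} {Ω₀ : Type*} [MeasurableSpace Ω₀] (ℙ : Measure Ω₀)
  (Λ : ℕ → Ω₀ → ℝ) (ζ : ℕ → DecisionRule B)

/-- Discounted expected number of packets dropped in epoch `t` at the node `i`. -/
def discountedDrops {V : Type} (G : SimpleGraph V) (z : V → Fin (B + 1)) (t : ℕ) (i : V) : ℝ≥0∞ :=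
  ∫⁻ x, ENNReal.ofReal (p.γ ^ t * packetDrops p G ζ (fun s => Λ s x.1) z x.2 t i)
    ∂(ℙ.prod (noiseMeasure V))

variable {Λ}

theorem measurable_packetDrops_prod (hΛ : ∀ t, Measurable (Λ t)) {V : Type} {G : SimpleGraph V}
    (hG : ∀ v, (G.neighborSet v).Finite) (z : V → Fin (B + 1)) (t : ℕ) (i : V) :
    Measurable fun x : Ω₀ × Noise V => packetDrops p G ζ (fun s => Λ s x.1) z x.2 t i :=
  measurable_packetDrops p hG ζ z (lam := fun (x : Ω₀ × Noise V) s => Λ s x.1)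
    (fun s => (hΛ s).comp measurable_fst) measurable_snd t i

/-- The drops agree realization by realization once the noise is pulled back along `f`, and the
pulled-back noise has the right law. -/
theorem discountedDrops_eq_of_comap [IsProbabilityMeasure ℙ] (hΛ : ∀ t, Measurable (Λ t))
    {V W : Type} {G : SimpleGraph V}
    {H : SimpleGraph W} (hG : ∀ v, (G.neighborSet v).Finite) {f : V → W} {r : V → ℕ} {T : ℕ}
    (hf : Function.Injective f) (hr : ∀ u v, G.Adj u v → r v ≤ r u + 1)
    (hgood : ∀ v, r v ≤ T + 1 → PreservesNeighbors G H f v)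
    {z : V → Fin (B + 1)} {z' : W → Fin (B + 1)} (hz : ∀ v, z' (f v) = z v) {t : ℕ}
    {v : V} (hv : r v + t ≤ T) :
    discountedDrops p ℙ Λ ζ H z' t (f v) = discountedDrops p ℙ Λ ζ G z t v := by
  have hmap : (ℙ.prod (noiseMeasure W)).map (Prod.map id (Noise.comap f)) =
      ℙ.prod (noiseMeasure V) := by
    rw [← Measure.map_prod_map _ _ measurable_id (Noise.measurable_comap f), Measure.map_id,
      noiseMeasure_map_comap hf]
  unfold discountedDrops
  rw [← hmap, lintegral_map
    ((measurable_packetDrops_prod p ζ hΛ hG z t v).const_mul _).ennreal_ofReal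
    (measurable_id.prodMap (Noise.measurable_comap f))]
  refine lintegral_congr fun x => ?_
  rw [packetDrops_eq_of_comap p ζ _ x.2 hf hr hgood hz hv]
  rfl

theorem discountedDrops_le [IsProbabilityMeasure ℙ] (hΛ0 : ∀ t ω, 0 ≤ Λ t ω) {lamMax : ℝ}
    (hΛmax : ∀ t ω, Λ t ω ≤ lamMax) {d : ℕ} {M : ℝ}
    (hM : ∀ r ∈ Set.Icc 0 (lamMax * (1 + d)), ∀ x : Fin (B + 1), expectedDrops p r x ≤ M)
    {V : Type} {G : SimpleGraph V} {i : V} (hi : (G.neighborSet i).Finite)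
    (hd : (G.neighborSet i).ncard ≤ d) (z : V → Fin (B + 1)) (t : ℕ) :
    discountedDrops p ℙ Λ ζ G z t i ≤ ENNReal.ofReal (p.γ ^ t * M) := by
  have hle : discountedDrops p ℙ Λ ζ G z t i ≤
      ∫⁻ _, ENNReal.ofReal (p.γ ^ t * M) ∂(ℙ.prod (noiseMeasure V)) := by
    refine lintegral_mono fun x => ENNReal.ofReal_le_ofReal
      (mul_le_mul_of_nonneg_left ?_ (pow_nonneg p.γ_nonneg t))
    exact hM _ ⟨arrivalRate_nonneg G (hΛ0 t _) _ i,
      arrivalRate_le hi hd (hΛ0 t _) (hΛmax t _) _⟩ _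
  simpa using hle

end Drops

/-! ### Isomorphic balls -/

namespace MarkedRootedGraph

section Balls

variable {Z : Type}

theorem root_mem_ball (g : MarkedRootedGraph Z) (k : ℕ) : g.root ∈ g.ball k := by
  simp [ball]

theorem BallIso.refl (k : ℕ) (g : MarkedRootedGraph Z) : BallIso k g g :=
  ⟨SimpleGraph.Iso.refl, fun _ => Iff.rfl, fun _ => rfl⟩

theorem isOpen_setOf_ballIso (k : ℕ) (g : MarkedRootedGraph Z) : IsOpen {h | BallIso k g h} :=
  TopologicalSpace.isOpen_generateFrom_of_mem ⟨k, g, rfl⟩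

theorem isLocallyConstant_of_ballIso {Y : Type*} {F : MarkedRootedGraph Z → Y} (k : ℕ)
    (hF : ∀ g h, BallIso k g h → F h = F g) : IsLocallyConstant F :=
  (IsLocallyConstant.iff_exists_open F).2 fun g =>
    ⟨{h | BallIso k g h}, isOpen_setOf_ballIso k g, BallIso.refl k g, fun h hh => hF g h hh⟩

variable {k : ℕ} {g h : MarkedRootedGraph Z}

/-- A shortest walk from `v` to the root never leaves the ball, since all its tails have length at
most `k`; so `φ` can be followed along it edge by edge. -/
theorem dist_le_of_iso (φ : g.graph.induce (g.ball k) ≃g h.graph.induce (h.ball k))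
    (hroot : ∀ v, v.1 = g.root ↔ (φ v).1 = h.root) (v : g.ball k) :
    h.graph.dist h.root (φ v).1 ≤ g.graph.dist g.root v.1 := by
  have key : ∀ (u x : g.V) (w : g.graph.Walk u x), x = g.root → w.length ≤ k →
      ∀ hu : u ∈ g.ball k, h.graph.dist h.root (φ ⟨u, hu⟩).1 ≤ w.length := by
    intro u x w
    induction w with
    | nil =>
      intro hx _ hu
      rw [(hroot ⟨_, hu⟩).1 hx]
      simp
    | @cons a b c hab w ih =>
      intro hx hlen hu
      rw [SimpleGraph.Walk.length_cons] at hlen ⊢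
      have hb : b ∈ g.ball k := by
        subst hx
        change g.graph.dist g.root b ≤ k
        rw [SimpleGraph.dist_comm]
        exact (SimpleGraph.dist_le w).trans (by omega)
      have hadj : h.graph.Adj (φ ⟨b, hb⟩).1 (φ ⟨a, hu⟩).1 :=
        φ.map_rel_iff.2 (show g.graph.Adj b a from hab.symm)
      have h1 := ih hx (by omega) hb
      have h2 := h.connected.dist_triangle (u := h.root) (v := (φ ⟨b, hb⟩).1) (w := (φ ⟨a, hu⟩).1)
      rw [SimpleGraph.dist_eq_one_iff_adj.2 hadj] at h2
      omega
  obtain ⟨w, hw⟩ := g.connected.exists_walk_length_eq_dist v.1 g.root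
  rw [SimpleGraph.dist_comm (u := g.root), ← hw]
  refine key _ _ w rfl ?_ v.2
  rw [hw, SimpleGraph.dist_comm]
  exact v.2

theorem preservesNeighbors_of_iso (φ : g.graph.induce (g.ball k) ≃g h.graph.induce (h.ball k))
    (hroot : ∀ v, v.1 = g.root ↔ (φ v).1 = h.root) (v : g.ball k)
    (hv : g.graph.dist g.root v.1 + 1 ≤ k) :
    PreservesNeighbors (g.graph.induce (g.ball k)) h.graph (fun v => (φ v).1) v := by
  ext w
  constructor
  · rintro ⟨u, hu, rfl⟩
    exact φ.map_rel_iff.2 hu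
  · intro hw
    -- Surjectivity onto the neighbours needs `w` in the range of `φ`; this is where `v` must lie
    -- strictly inside the ball.
    have hmem : w ∈ h.ball k := by
      have h1 := dist_le_of_iso φ hroot v
      have h2 := h.connected.dist_triangle (u := h.root) (v := (φ v).1) (w := w)
      rw [SimpleGraph.dist_eq_one_iff_adj.2 hw] at h2
      change h.graph.dist h.root w ≤ k
      omega
    refine ⟨φ.symm ⟨w, hmem⟩, φ.map_rel_iff.1 ?_, by simp⟩
    rw [RelIso.apply_symm_apply]
    exact hw

theorem degree_root_eq_of_ballIso (hk : 1 ≤ k) (hgh : BallIso k g h) :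
    (h.graph.neighborSet h.root).ncard = (g.graph.neighborSet g.root).ncard := by
  -- Both sides are compared with the ball of `g`, taking `h' = h` and `h' = g`, so no symmetry of
  -- `BallIso` is needed.
  have key : ∀ h', BallIso k g h' → (h'.graph.neighborSet h'.root).ncard =
      ((g.graph.induce (g.ball k)).neighborSet ⟨g.root, g.root_mem_ball k⟩).ncard := by
    rintro h' ⟨φ, hroot, -⟩
    have hn := preservesNeighbors_of_iso φ hroot ⟨g.root, g.root_mem_ball k⟩ (by simpa using hk)
    have := hn.ncard_eq (Subtype.val_injective.comp φ.injective)
    rwa [Function.comp_apply, (hroot ⟨g.root, g.root_mem_ball k⟩).1 rfl] at this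
  rw [key h hgh, key g (BallIso.refl k g)]

end Balls

section Drops

variable (p : QueueParams) {B : ℕ} {Ω₀ : Type*} [MeasurableSpace Ω₀] (ℙ : Measure Ω₀)
  {Λ : ℕ → Ω₀ → ℝ} (ζ : ℕ → DecisionRule B)

theorem discountedDrops_root_eq_of_ballIso [IsProbabilityMeasure ℙ]
    (hΛ : ∀ t, Measurable (Λ t)) {t : ℕ} {g h : MarkedRootedGraph (Fin (B + 1))}
    (hgh : BallIso (t + 2) g h) :
    discountedDrops p ℙ Λ ζ h.graph h.mark t h.root =
      discountedDrops p ℙ Λ ζ g.graph g.mark t g.root := by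
  have hfin : ∀ v, ((g.graph.induce (g.ball (t + 2))).neighborSet v).Finite := fun v =>
    (g.locallyFinite v.1).preimage (f := Subtype.val) Subtype.val_injective.injOn
  have key : ∀ h', BallIso (t + 2) g h' → discountedDrops p ℙ Λ ζ h'.graph h'.mark t h'.root =
      discountedDrops p ℙ Λ ζ (g.graph.induce (g.ball (t + 2))) (fun v => g.mark v.1) t
        ⟨g.root, g.root_mem_ball _⟩ := by
    rintro h' ⟨φ, hroot, hmark⟩
    rw [← (hroot ⟨g.root, g.root_mem_ball _⟩).1 rfl]
    refine discountedDrops_eq_of_comap p ℙ ζ hΛ hfin (f := fun v => (φ v).1)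
      (r := fun v => g.graph.dist g.root v.1) (T := t)
      (Subtype.val_injective.comp φ.injective) (fun u v huv => ?_)
      (fun v hv => preservesNeighbors_of_iso φ hroot v (by omega)) hmark (by simp)
    have h2 := g.connected.dist_triangle (u := g.root) (v := u.1) (w := v.1)
    rwa [SimpleGraph.dist_eq_one_iff_adj.2 (show g.graph.Adj u.1 v.1 from huv)] at h2
  rw [key h hgh, key g (BallIso.refl _ g)]

end Drops

end MarkedRootedGraph

/-! ### A node of a finite graph versus the root of its component -/

namespace FiniteMarkedGraph

theorem preservesNeighbors_component {Z : Type} (g : FiniteMarkedGraph Z) (i : Fin g.size)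
    (v : (g.component i).V) :
    PreservesNeighbors (g.component i).graph g.graph
      (Subtype.val : g.graph.connectedComponentMk i → Fin g.size) v := by
  ext w
  constructor
  · rintro ⟨u, hu, rfl⟩
    exact hu
  · intro hw
    exact ⟨⟨w, ((g.graph.connectedComponentMk i).mem_supp_congr_adj hw).1 v.2⟩, hw, rfl⟩

theorem degree_component {Z : Type} (g : FiniteMarkedGraph Z) (i : Fin g.size) :
    ((g.component i).graph.neighborSet (g.component i).root).ncard =
      (g.graph.neighborSet i).ncard :=
  ((g.preservesNeighbors_component i (g.component i).root).ncard_eq Subtype.val_injective).symm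

theorem discountedDrops_component (p : QueueParams) {B : ℕ} {Ω₀ : Type*} [MeasurableSpace Ω₀]
    (ℙ : Measure Ω₀) [IsProbabilityMeasure ℙ] {Λ : ℕ → Ω₀ → ℝ} (ζ : ℕ → DecisionRule B)
    (hΛ : ∀ t, Measurable (Λ t)) (g : FiniteMarkedGraph (Fin (B + 1))) (t : ℕ)
    (i : Fin g.size) :
    discountedDrops p ℙ Λ ζ g.graph g.mark t i =
      discountedDrops p ℙ Λ ζ (g.component i).graph (g.component i).mark t
        (g.component i).root :=
  discountedDrops_eq_of_comap p ℙ ζ hΛ (g.component i).locallyFinite (r := fun _ => 0) (T := t)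
    (v := (g.component i).root) Subtype.val_injective (fun _ _ _ => Nat.zero_le _)
    (fun v _ => g.preservesNeighbors_component i v) (fun _ => rfl) (by simp)

end FiniteMarkedGraph

/-- Bounded convergence theorem for convergence in measure. -/
theorem tendsto_integral_of_tendstoInMeasure_of_bounded {Ω : Type*} [MeasurableSpace Ω]
    {P : Measure Ω} [IsFiniteMeasure P] {Y : ℕ → Ω → ℝ} {y : Ω → ℝ} {C : ℝ}
    (hY : ∀ n, AEStronglyMeasurable (Y n) P) (hC : ∀ n, ∀ᵐ ω ∂P, ‖Y n ω‖ ≤ C)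
    (h : TendstoInMeasure P Y atTop y) :
    Tendsto (fun n => ∫ ω, Y n ω ∂P) atTop (𝓝 (∫ ω, y ω ∂P)) := by
  -- Every subsequence has a further one converging almost everywhere, to which dominated
  -- convergence applies.
  refine tendsto_of_subseq_tendsto fun ns hns => ?_
  obtain ⟨ms, -, hms⟩ := (h.comp hns).exists_seq_tendsto_ae
  exact ⟨ms, tendsto_integral_of_dominated_convergence (fun _ => C) (fun n => hY _)
    (integrable_const C) (fun n => hC _) hms⟩

/-! ### The cost as a function of the marked rooted graph -/

section Cost

variable (p : QueueParams) {B : ℕ} {Ω₀ : Type*} [MeasurableSpace Ω₀] (ℙ : Measure Ω₀)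
  (Λ : ℕ → Ω₀ → ℝ) (ζ : ℕ → DecisionRule B) (d : ℕ)

open Classical in
/-- The discounted expected drops at the root in epoch `t`, set to zero if the degree of the root
exceeds `d`. -/
def truncatedDrops (t : ℕ) (g : MarkedRootedGraph (Fin (B + 1))) : ℝ :=
  if (g.graph.neighborSet g.root).ncard ≤ d then
    (discountedDrops p ℙ Λ ζ g.graph g.mark t g.root).toReal else 0

/-- The discounted expected drops at the root in all epochs, set to zero if the degree of the root
exceeds `d`. -/
def truncatedCost (g : MarkedRootedGraph (Fin (B + 1))) : ℝ := ∑' t, truncatedDrops p ℙ Λ ζ d t g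

theorem truncatedDrops_nonneg (t : ℕ) (g : MarkedRootedGraph (Fin (B + 1))) :
    0 ≤ truncatedDrops p ℙ Λ ζ d t g := by
  unfold truncatedDrops
  split_ifs
  exacts [ENNReal.toReal_nonneg, le_rfl]

theorem truncatedCost_nonneg (g : MarkedRootedGraph (Fin (B + 1))) :
    0 ≤ truncatedCost p ℙ Λ ζ d g :=
  tsum_nonneg fun t => truncatedDrops_nonneg p ℙ Λ ζ d t g

theorem summable_discounted (M : ℝ) : Summable fun t : ℕ => p.γ ^ t * M :=
  (summable_geometric_of_lt_one p.γ_nonneg p.γ_lt_one).mul_right M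

variable {Λ}

theorem continuous_truncatedDrops [IsProbabilityMeasure ℙ] (hΛ : ∀ t, Measurable (Λ t)) (t : ℕ) :
    Continuous (truncatedDrops p ℙ Λ ζ d t) := by
  refine (MarkedRootedGraph.isLocallyConstant_of_ballIso (t + 2) fun g h hgh => ?_).continuous
  unfold truncatedDrops
  rw [MarkedRootedGraph.degree_root_eq_of_ballIso (by omega) hgh,
    MarkedRootedGraph.discountedDrops_root_eq_of_ballIso p ℙ ζ hΛ hgh]

variable {d} {M : ℝ}

theorem truncatedDrops_le (hM0 : 0 ≤ M)
    (hM : ∀ (g : MarkedRootedGraph (Fin (B + 1))) (t : ℕ),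
      (g.graph.neighborSet g.root).ncard ≤ d →
        discountedDrops p ℙ Λ ζ g.graph g.mark t g.root ≤ ENNReal.ofReal (p.γ ^ t * M))
    (t : ℕ) (g : MarkedRootedGraph (Fin (B + 1))) :
    truncatedDrops p ℙ Λ ζ d t g ≤ p.γ ^ t * M := by
  have h0 : 0 ≤ p.γ ^ t * M := mul_nonneg (pow_nonneg p.γ_nonneg t) hM0
  unfold truncatedDrops
  split_ifs with h
  exacts [ENNReal.toReal_le_of_le_ofReal h0 (hM g t h), h0]

theorem norm_truncatedDrops_le (hM0 : 0 ≤ M)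
    (hM : ∀ (g : MarkedRootedGraph (Fin (B + 1))) (t : ℕ),
      (g.graph.neighborSet g.root).ncard ≤ d →
        discountedDrops p ℙ Λ ζ g.graph g.mark t g.root ≤ ENNReal.ofReal (p.γ ^ t * M))
    (t : ℕ) (g : MarkedRootedGraph (Fin (B + 1))) :
    ‖truncatedDrops p ℙ Λ ζ d t g‖ ≤ p.γ ^ t * M := by
  rw [Real.norm_of_nonneg (truncatedDrops_nonneg p ℙ Λ ζ d t g)]
  exact truncatedDrops_le p ℙ ζ hM0 hM t g

/-- The sum depends on balls of all radii, so it need not be locally constant; the geometric bound,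
uniform in `g` thanks to the truncation, still gives continuity. -/
theorem continuous_truncatedCost [IsProbabilityMeasure ℙ] (hΛ : ∀ t, Measurable (Λ t))
    (hM0 : 0 ≤ M)
    (hM : ∀ (g : MarkedRootedGraph (Fin (B + 1))) (t : ℕ),
      (g.graph.neighborSet g.root).ncard ≤ d →
        discountedDrops p ℙ Λ ζ g.graph g.mark t g.root ≤ ENNReal.ofReal (p.γ ^ t * M)) :
    Continuous (truncatedCost p ℙ Λ ζ d) :=
  continuous_tsum (continuous_truncatedDrops p ℙ ζ d hΛ) (summable_discounted p M)
    (norm_truncatedDrops_le p ℙ ζ hM0 hM)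

theorem truncatedCost_le (hM0 : 0 ≤ M)
    (hM : ∀ (g : MarkedRootedGraph (Fin (B + 1))) (t : ℕ),
      (g.graph.neighborSet g.root).ncard ≤ d →
        discountedDrops p ℙ Λ ζ g.graph g.mark t g.root ≤ ENNReal.ofReal (p.γ ^ t * M))
    (g : MarkedRootedGraph (Fin (B + 1))) :
    truncatedCost p ℙ Λ ζ d g ≤ ∑' t : ℕ, p.γ ^ t * M :=
  (Summable.of_norm_bounded (summable_discounted p M)
    fun t => norm_truncatedDrops_le p ℙ ζ hM0 hM t g).tsum_le_tsum
    (fun t => truncatedDrops_le p ℙ ζ hM0 hM t g) (summable_discounted p M)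

theorem tsum_discountedDrops_eq (hM0 : 0 ≤ M)
    (hM : ∀ (g : MarkedRootedGraph (Fin (B + 1))) (t : ℕ),
      (g.graph.neighborSet g.root).ncard ≤ d →
        discountedDrops p ℙ Λ ζ g.graph g.mark t g.root ≤ ENNReal.ofReal (p.γ ^ t * M))
    {g : MarkedRootedGraph (Fin (B + 1))} (hg : (g.graph.neighborSet g.root).ncard ≤ d) :
    ∑' t, discountedDrops p ℙ Λ ζ g.graph g.mark t g.root =
      ENNReal.ofReal (truncatedCost p ℙ Λ ζ d g) := by
  unfold truncatedCost
  rw [ENNReal.ofReal_tsum_of_nonneg (fun t => truncatedDrops_nonneg p ℙ Λ ζ d t g)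
    (Summable.of_norm_bounded (summable_discounted p M)
      fun t => norm_truncatedDrops_le p ℙ ζ hM0 hM t g)]
  refine tsum_congr fun t => ?_
  rw [truncatedDrops, if_pos hg, ENNReal.ofReal_toReal ((hM g t hg).trans_lt ENNReal.ofReal_lt_top).ne]

end Cost

/-! ### The two systems -/

section Systems

variable (p : QueueParams) {B : ℕ} {Ω₀ : Type*} [MeasurableSpace Ω₀] (ℙ : Measure Ω₀)
  {Λ : ℕ → Ω₀ → ℝ} (ζ : ℕ → DecisionRule B)

/-- Sum and integral are exchanged for each fixed `g`, so measurability in `g` is not at issue. -/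
theorem limitCost_eq_lintegral_tsum (hΛ : ∀ t, Measurable (Λ t))
    (L : Measure (MarkedRootedGraph (Fin (B + 1)))) :
    limitCost p ℙ Λ L ζ =
      ∫⁻ g, ∑' t, discountedDrops p ℙ Λ ζ g.graph g.mark t g.root ∂L := by
  refine lintegral_congr fun g => lintegral_tsum fun t => ?_
  exact ((measurable_packetDrops_prod p ζ hΛ g.locallyFinite g.mark t
    g.root).const_mul _).ennreal_ofReal.aemeasurable

/-- The average of a function of marked rooted graphs over the components of a finite graph. -/
def FiniteMarkedGraph.average {Z : Type} (f : MarkedRootedGraph Z → ℝ)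
    (g : FiniteMarkedGraph Z) : ℝ :=
  (∑ i, f (g.component i)) / (g.size : ℝ)

theorem FiniteMarkedGraph.average_nonneg {Z : Type} {f : MarkedRootedGraph Z → ℝ}
    (hf : ∀ g, 0 ≤ f g) (g : FiniteMarkedGraph Z) : 0 ≤ g.average f :=
  div_nonneg (Finset.sum_nonneg fun _ _ => hf _) (Nat.cast_nonneg _)

theorem FiniteMarkedGraph.average_le {Z : Type} {f : MarkedRootedGraph Z → ℝ} {C : ℝ}
    (hf : ∀ g, f g ≤ C) (g : FiniteMarkedGraph Z) : g.average f ≤ C := by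
  have hs : (0 : ℝ) < g.size := by exact_mod_cast g.size_pos
  rw [FiniteMarkedGraph.average, div_le_iff₀ hs]
  refine (Finset.sum_le_sum fun i _ => hf _).trans_eq ?_
  simp [mul_comm]

theorem lintegral_tsum_average_drops [IsProbabilityMeasure ℙ] (hΛ : ∀ t, Measurable (Λ t))
    (hΛ0 : ∀ t ω, 0 ≤ Λ t ω) {d : ℕ} {M : ℝ} (hM0 : 0 ≤ M)
    (hM : ∀ (g : MarkedRootedGraph (Fin (B + 1))) (t : ℕ),
      (g.graph.neighborSet g.root).ncard ≤ d →
        discountedDrops p ℙ Λ ζ g.graph g.mark t g.root ≤ ENNReal.ofReal (p.γ ^ t * M))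
    (g : FiniteMarkedGraph (Fin (B + 1))) (hg : ∀ i, (g.graph.neighborSet i).ncard ≤ d) :
    ∫⁻ x, ∑' t : ℕ, ENNReal.ofReal
      (p.γ ^ t * ((∑ i, packetDrops p g.graph ζ (fun s => Λ s x.1) g.mark x.2 t i) /
        (g.size : ℝ))) ∂(ℙ.prod (noiseMeasure (Fin g.size))) =
      ENNReal.ofReal (g.average (truncatedCost p ℙ Λ ζ d)) := by
  have hs : (0 : ℝ) < g.size := by exact_mod_cast g.size_pos
  have hmeas : ∀ t i, Measurable fun x : Ω₀ × Noise (Fin g.size) =>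
      packetDrops p g.graph ζ (fun s => Λ s x.1) g.mark x.2 t i :=
    fun t i => measurable_packetDrops_prod p ζ hΛ (fun _ => Set.toFinite _) g.mark t i
  have hsplit : ∀ (x : Ω₀ × Noise (Fin g.size)) (t : ℕ), ENNReal.ofReal
      (p.γ ^ t * ((∑ i, packetDrops p g.graph ζ (fun s => Λ s x.1) g.mark x.2 t i) /
        (g.size : ℝ))) = (∑ i, ENNReal.ofReal
          (p.γ ^ t * packetDrops p g.graph ζ (fun s => Λ s x.1) g.mark x.2 t i)) *
          ENNReal.ofReal ((g.size : ℝ)⁻¹) := by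
    intro x t
    have h0 : ∀ i, 0 ≤ p.γ ^ t * packetDrops p g.graph ζ (fun s => Λ s x.1) g.mark x.2 t i :=
      fun i => mul_nonneg (pow_nonneg p.γ_nonneg t)
        (packetDrops_nonneg p g.graph ζ (fun s => hΛ0 s x.1) g.mark x.2 t i)
    rw [← ENNReal.ofReal_sum_of_nonneg fun i _ => h0 i,
      ← ENNReal.ofReal_mul (Finset.sum_nonneg fun i _ => h0 i), ← Finset.mul_sum, div_eq_mul_inv,
      mul_assoc]
  have hsum : ∀ t, Measurable fun x : Ω₀ × Noise (Fin g.size) => ∑ i, ENNReal.ofReal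
      (p.γ ^ t * packetDrops p g.graph ζ (fun s => Λ s x.1) g.mark x.2 t i) :=
    fun t => Finset.measurable_sum _ fun i _ => ((hmeas t i).const_mul _).ennreal_ofReal
  simp only [hsplit]
  rw [lintegral_tsum fun t => ((hsum t).mul_const _).aemeasurable]
  have hterm : ∀ t, ∫⁻ x, (∑ i, ENNReal.ofReal
      (p.γ ^ t * packetDrops p g.graph ζ (fun s => Λ s x.1) g.mark x.2 t i)) *
          ENNReal.ofReal ((g.size : ℝ)⁻¹) ∂(ℙ.prod (noiseMeasure (Fin g.size))) =
      (∑ i, discountedDrops p ℙ Λ ζ (g.component i).graph (g.component i).mark t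
        (g.component i).root) * ENNReal.ofReal ((g.size : ℝ)⁻¹) := by
    intro t
    rw [lintegral_mul_const _ (hsum t),
      lintegral_finsetSum _ fun i _ => ((hmeas t i).const_mul _).ennreal_ofReal]
    congr 1
    exact Finset.sum_congr rfl fun i _ => g.discountedDrops_component p ℙ ζ hΛ t i
  simp only [hterm]
  rw [ENNReal.tsum_mul_right, Summable.tsum_finsetSum fun i _ => ENNReal.summable,
    FiniteMarkedGraph.average, div_eq_mul_inv,
    ENNReal.ofReal_mul (Finset.sum_nonneg fun i _ => truncatedCost_nonneg p ℙ Λ ζ d _),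
    ENNReal.ofReal_sum_of_nonneg fun i _ => truncatedCost_nonneg p ℙ Λ ζ d _]
  congr 1
  refine Finset.sum_congr rfl fun i _ => ?_
  refine tsum_discountedDrops_eq p ℙ ζ hM0 hM ?_
  rw [g.degree_component i]
  exact hg i

end Systems

/-! ### The limiting graph has bounded degree at the root -/

-- The event that the root has degree at most `d` is determined by the `1`-ball, so its indicator is
-- an admissible test function. Its averages over the finite graphs are almost surely `1`, hence so
-- is its integral under `L`.
open Classical in
theorem ae_degree_root_le {Z : Type} {Ω : Type*} [MeasurableSpace Ω] {P : Measure Ω}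
    [IsProbabilityMeasure P] {X : ℕ → Ω → FiniteMarkedGraph Z} {d : ℕ}
    (hd : ∀ n, ∀ᵐ ω ∂P, ∀ i, ((X n ω).graph.neighborSet i).ncard ≤ d)
    {L : Measure (MarkedRootedGraph Z)} [IsProbabilityMeasure L]
    (hconv : LocalWeakConvergesInProbability P X L) :
    ∀ᵐ g ∂L, (g.graph.neighborSet g.root).ncard ≤ d := by
  let S : Set (MarkedRootedGraph Z) := {g | (g.graph.neighborSet g.root).ncard ≤ d}
  have hcont : Continuous (S.indicator fun _ => (1 : ℝ)) := by
    refine (MarkedRootedGraph.isLocallyConstant_of_ballIso 1 fun g h hgh => ?_).continuous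
    have hiff : h ∈ S ↔ g ∈ S := by
      simp only [S, Set.mem_ofPred_eq, MarkedRootedGraph.degree_root_eq_of_ballIso le_rfl hgh]
    simp only [Set.indicator_apply, hiff]
  have hS : MeasurableSet S := by
    have h := hcont.measurable (measurableSet_singleton (1 : ℝ))
    convert h using 1
    ext g
    by_cases hg : g ∈ S <;> simp [hg]
  let f : MarkedRootedGraph Z →ᵇ ℝ := BoundedContinuousFunction.ofNormedAddCommGroup
    (S.indicator fun _ => (1 : ℝ)) hcont 1 fun g => by
      by_cases hg : g ∈ S <;> simp [hg]
  have hone : TendstoInMeasure P (fun n ω => (∑ i, f ((X n ω).component i)) / ((X n ω).size : ℝ))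
      atTop (fun _ => (1 : ℝ)) := by
    have h1 : TendstoInMeasure P (fun (_ : ℕ) (_ : Ω) => (1 : ℝ)) atTop (fun _ => (1 : ℝ)) :=
      tendstoInMeasure_of_tendsto_ae (fun _ => aestronglyMeasurable_const)
        (ae_of_all _ fun _ => tendsto_const_nhds)
    refine h1.congr_left fun n => ?_
    filter_upwards [hd n] with ω hω
    have hs : ((X n ω).size : ℝ) ≠ 0 := by exact_mod_cast (X n ω).size_pos.ne'
    have hf : ∀ i, f ((X n ω).component i) = 1 := fun i => by
      have hi : (X n ω).component i ∈ S := by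
        simp only [S, Set.mem_ofPred_eq, FiniteMarkedGraph.degree_component]
        exact hω i
      exact Set.indicator_of_mem hi fun _ => (1 : ℝ)
    simp [hf, hs]
  -- Two constants that agree almost everywhere for a probability measure are equal.
  have hae := tendstoInMeasure_ae_unique (hconv f) hone
  obtain ⟨_, hint⟩ := hae.exists
  have hint' : L.real S = 1 := by
    rw [← integral_indicator_one hS]
    exact hint
  have hL : L S = 1 := by
    rw [← ENNReal.toReal_eq_one_iff]
    exact hint'
  exact (mem_ae_iff_prob_eq_one hS).2 hL

/-! ### Convergence of the costs for a fixed sequence of decision rules -/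

theorem tendsto_costs {B : ℕ} (p : QueueParams)
    {Ω₀ : Type*} [MeasurableSpace Ω₀] (ℙ : Measure Ω₀) [IsProbabilityMeasure ℙ]
    {Λ : ℕ → Ω₀ → ℝ} (hΛ : ∀ t, Measurable (Λ t)) (hΛ0 : ∀ t ω, 0 ≤ Λ t ω)
    {lamMax : ℝ} (hΛmax : ∀ t ω, Λ t ω ≤ lamMax)
    {Ω : Type*} [MeasurableSpace Ω] {P : Measure Ω} [IsProbabilityMeasure P]
    {X : ℕ → Ω → FiniteMarkedGraph (Fin (B + 1))} (hX : ∀ n, Measurable (X n))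
    {d : ℕ} (hd : ∀ n, ∀ᵐ ω ∂P, ∀ i, ((X n ω).graph.neighborSet i).ncard ≤ d)
    {L : Measure (MarkedRootedGraph (Fin (B + 1)))} [IsProbabilityMeasure L]
    (hconv : LocalWeakConvergesInProbability P X L) (ζ : ℕ → DecisionRule B) :
    (∀ n, finiteCost p ℙ Λ P (X n) ζ ≠ ∞) ∧ limitCost p ℙ Λ L ζ ≠ ∞ ∧
      Tendsto (fun n => (finiteCost p ℙ Λ P (X n) ζ).toReal) atTop
        (𝓝 (limitCost p ℙ Λ L ζ).toReal) := by
  obtain ⟨M, hM0, hMr⟩ := exists_expectedDrops_le p B (lamMax * (1 + d))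
  have hM : ∀ (g : MarkedRootedGraph (Fin (B + 1))) (t : ℕ),
      (g.graph.neighborSet g.root).ncard ≤ d →
        discountedDrops p ℙ Λ ζ g.graph g.mark t g.root ≤ ENNReal.ofReal (p.γ ^ t * M) :=
    fun g t hg => discountedDrops_le p ℙ ζ hΛ0 hΛmax hMr (g.locallyFinite _) hg _ t
  set F := truncatedCost p ℙ Λ ζ d
  have hF0 : ∀ g, 0 ≤ F g := truncatedCost_nonneg p ℙ Λ ζ d
  have hFcont : Continuous F := continuous_truncatedCost p ℙ ζ hΛ hM0 hM
  have hFle : ∀ g, F g ≤ ∑' t : ℕ, p.γ ^ t * M := truncatedCost_le p ℙ ζ hM0 hM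
  set C := ∑' t : ℕ, p.γ ^ t * M
  have hFnorm : ∀ g, ‖F g‖ ≤ C := fun g => by
    rw [Real.norm_of_nonneg (hF0 g)]
    exact hFle g
  have hFint : Integrable F L :=
    Integrable.of_bound hFcont.measurable.aestronglyMeasurable C (ae_of_all _ hFnorm)
  have hlim : limitCost p ℙ Λ L ζ = ENNReal.ofReal (∫ g, F g ∂L) := by
    rw [limitCost_eq_lintegral_tsum p ℙ ζ hΛ,
      ofReal_integral_eq_lintegral_ofReal hFint (ae_of_all _ hF0)]
    refine lintegral_congr_ae ?_
    -- Almost surely under `L` the truncation has no effect.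
    filter_upwards [ae_degree_root_le hd hconv] with g hg
    exact tsum_discountedDrops_eq p ℙ ζ hM0 hM hg
  have hYmeas : ∀ n, AEStronglyMeasurable (fun ω => (X n ω).average F) P := fun n =>
    ((measurable_from_top (f := FiniteMarkedGraph.average F)).comp (hX n)).aestronglyMeasurable
  have hY0 : ∀ n ω, 0 ≤ (X n ω).average F := fun n ω => FiniteMarkedGraph.average_nonneg hF0 _
  have hYnorm : ∀ n ω, ‖(X n ω).average F‖ ≤ C := fun n ω => by
    rw [Real.norm_of_nonneg (hY0 n ω)]
    exact FiniteMarkedGraph.average_le hFle _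
  have hfin : ∀ n, finiteCost p ℙ Λ P (X n) ζ = ENNReal.ofReal (∫ ω, (X n ω).average F ∂P) := by
    intro n
    rw [ofReal_integral_eq_lintegral_ofReal
      (Integrable.of_bound (hYmeas n) C (ae_of_all _ (hYnorm n))) (ae_of_all _ (hY0 n))]
    refine lintegral_congr_ae ?_
    filter_upwards [hd n] with ω hω
    exact lintegral_tsum_average_drops p ℙ ζ hΛ hΛ0 hM0 hM (X n ω) hω
  refine ⟨fun n => by rw [hfin]; exact ENNReal.ofReal_ne_top,
    by rw [hlim]; exact ENNReal.ofReal_ne_top, ?_⟩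
  simp only [hfin, hlim]
  rw [ENNReal.toReal_ofReal (integral_nonneg hF0)]
  simp only [ENNReal.toReal_ofReal (integral_nonneg (hY0 _))]
  have h := tendsto_integral_of_tendstoInMeasure_of_bounded hYmeas
    (fun n => ae_of_all _ (hYnorm n))
    (hconv (BoundedContinuousFunction.ofNormedAddCommGroup F hFcont C hFnorm))
  simpa using h

end

theorem theorem2p1 {B : ℕ} (p : QueueParams)
    -- the arrival rate process
    {Ω₀ : Type*} [MeasurableSpace Ω₀] (ℙ : Measure Ω₀) [IsProbabilityMeasure ℙ]
    (Λ : ℕ → Ω₀ → ℝ) (hΛ : ∀ t, Measurable (Λ t)) (hΛ0 : ∀ t ω, 0 ≤ Λ t ω)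
    (lamMax : ℝ) (hΛmax : ∀ t ω, Λ t ω ≤ lamMax)
    -- the random finite graphs and initial states, of bounded degree
    {Ω : Type*} [MeasurableSpace Ω] (P : Measure Ω) [IsProbabilityMeasure P]
    (X : ℕ → Ω → FiniteMarkedGraph (Fin (B + 1))) (hX : ∀ n, Measurable (X n))
    (d : ℕ) (hd : ∀ n, ∀ᵐ ω ∂P, ∀ i, ((X n ω).graph.neighborSet i).ncard ≤ d)
    -- the law of the limiting marked rooted graph
    (L : Measure (MarkedRootedGraph (Fin (B + 1)))) [IsProbabilityMeasure L]
    (hconv : LocalWeakConvergesInProbability P X L)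
    (π : UpperPolicy B) :
    (∀ n, finiteCost p ℙ Λ P (X n) (mfcControl p ℙ Λ L π) ≠ ∞) ∧
      limitCost p ℙ Λ L (mfcControl p ℙ Λ L π) ≠ ∞ ∧
      Tendsto (fun n => finiteObjective p ℙ Λ L P (X n) π) atTop
        (𝓝 (limitObjective p ℙ Λ L π)) := by
  -- `mfcControl` does not depend on `n`, so no regularity of `π` enters.
  obtain ⟨hfin, hlim, htendsto⟩ :=
    tendsto_costs p ℙ hΛ hΛ0 hΛmax hX hd hconv (mfcControl p ℙ Λ L π)
  exact ⟨hfin, hlim, htendsto.neg⟩
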